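/- Let $\sigma>\tfrac12$ be fixed. Let $\Omega=\mathbb T^{P}$, where $\mathbb T\subset\mathbb C$ is the unit circle with its uniform probability measure $\frac{1}{2\pi}d\theta$ and $P$ is the set of primes, and equip $\Omega$ with the product probability measure $\mathbb P$. For $\omega=(z_p)_{p\in P}\in\Omega$ put $$S(\omega)=-\sum_{p}\log\bigl(1-p^{-\sigma}z_p\bigr)$$ (principal logarithms, the primes $p$ taken in increasing order). This series converges $\mathbb P$-almost everywhere, and $S$ is a complex random variable. Let $\psi_\sigma(x)=\mathbb E\bigl[\exp(i x\,\Im S)\bigr]$, $x\in\mathbb R$, be the characteristic function of $\Im S$, and for $b>1$ and $x\in\mathbb R$ let $$I(b,x)=\frac1{2\pi}\int_0^{2\pi}\exp\bigl(-ix\arg(1-b^{-1}e^{i\theta})\bigr)\,d\theta .$$ Then $\psi_\sigma(x)=\prod_{p}I(p^\sigma,x)$ for all real $x$, the product over all primes being convergent in every order of the factors (the finite partial products converge to $\psi_\sigma(x)$, which may be $0$). For every prime $p$ the factor $I(p^\sigma,\cdot)$ has infinitely many real zeros, and the function $\psi_\sigma$ has infinitely many real zeros. -/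

import Mathlib

open MeasureTheory Filter Topology

noncomputable section

namespace BohrJessen

/-- The Borel σ-algebra on the unit circle. -/
instance : MeasurableSpace Circle := borel Circle

instance : BorelSpace Circle := ⟨rfl⟩

/-- The usual probability measure `dθ / 2π` (`0 ≤ θ < 2π`) on the unit circle. -/
def circleMeasure : Measure Circle :=
  ((ENNReal.ofReal (2 * Real.pi))⁻¹ •
    (volume.restrict (Set.Ico (0 : ℝ) (2 * Real.pi)))).map Circle.exp

instance : IsProbabilityMeasure circleMeasure := by
  have h0 : ENNReal.ofReal (2 * Real.pi) ≠ 0 := by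
    simp [Real.pi_pos]
  have : IsProbabilityMeasure ((ENNReal.ofReal (2 * Real.pi))⁻¹ •
      (volume.restrict (Set.Ico (0 : ℝ) (2 * Real.pi)))) := by
    constructor
    rw [Measure.smul_apply, Measure.restrict_apply_univ, Real.volume_Ico, sub_zero, smul_eq_mul,
      ENNReal.inv_mul_cancel h0 ENNReal.ofReal_ne_top]
  exact Measure.isProbabilityMeasure_map Circle.exp.continuous.measurable.aemeasurable

/-- The sample space: families `(z_p)` of points of the unit circle indexed by the primes. -/
abbrev Omega : Type := Nat.Primes → Circle

/-- The product probability measure on the sample space. -/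
def prodMeasure : Measure Omega := Measure.infinitePi fun _ => circleMeasure

/-- The finite set of primes less than `N`. -/
def primesLT (N : ℕ) : Finset Nat.Primes := (Finset.range N).subtype Nat.Prime

theorem mem_primesLT (N : ℕ) (p : Nat.Primes) : p ∈ primesLT N ↔ (p : ℕ) < N :=
  (Finset.mem_subtype (p := Nat.Prime) (s := Finset.range N) (a := p)).trans Finset.mem_range

/-- The partial sum over the primes `p < N` of `-log (1 - p ^ (-σ) z_p)`
(principal logarithm). -/
def partialS (σ : ℝ) (N : ℕ) (ω : Omega) : ℂ :=
  ∑ p ∈ primesLT N, -Complex.log (1 - (((p : ℕ) : ℝ) ^ (-σ) : ℝ) * (ω p : ℂ))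

/-- The random variable `S = -∑_p log (1 - p ^ (-σ) z_p)`, the primes being taken in
increasing order (for `σ ≤ 1` the convergence is only conditional). -/
def S (σ : ℝ) (ω : Omega) : ℂ := limUnder atTop fun N : ℕ => partialS σ N ω

/-- The characteristic function of `Im S`: `ψ_σ(x) = E[exp (i x Im S)]`. -/
def psi (σ x : ℝ) : ℂ :=
  ∫ ω, Complex.exp (Complex.I * x * (S σ ω).im) ∂prodMeasure

/-- `I(b, x) = (1 / 2π) ∫_0^{2π} exp (-i x arg (1 - b⁻¹ e^{iθ})) dθ`. -/
def I (b x : ℝ) : ℂ :=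
  1 / (2 * Real.pi) * ∫ θ in (0 : ℝ)..(2 * Real.pi),
    Complex.exp (-Complex.I * x * Complex.arg (1 - (b : ℂ)⁻¹ * Complex.exp (Complex.I * θ)))

end BohrJessen

end

/-! A zero of a single factor is a zero of the whole product, so it suffices that `p = 2`
contributes infinitely many zeros. The factor of `p` is the characteristic function `φ` of the law
`argLaw a` of `-arg (1 - a z)`, `a = p ^ (-σ)`. This law is symmetric, so `φ` is real. If `φ` had
finitely many zeros, it would have constant sign for large `|x|`, and `∫ |φ|` against a Gaussian of
variance `v` would be controlled by `∫ φ`, that is, by the mass of the law within about `v ^ (-1/2)`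
of the origin. That mass is `O(v ^ (-1/2))`, so the density would be bounded near every point
(`exists_gaussian_mean_le_of_finite_zeros`). But the angle is stationary at `θ = arccos a`, its
extreme position, where the density blows up: the Gaussian mean there is at least of order `v ^
(-1/4)` (`le_gaussian_mean_argLaw`), a contradiction.

The terms of `S` are independent, centred and `O(p ^ (-σ))`, so for `2σ > 1` Kolmogorov's theorem
gives convergence. Independence and dominated convergence give the product along increasing primes;
`I - 1 = O(p ^ (-2σ))` makes it unconditional. -/

open ProbabilityTheory

/-! ### Almost sure convergence of random series. -/

/-- Kolmogorov's theorem on series of independent centred square-integrable variables. -/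
theorem ae_exists_tendsto_sum_of_summable_variance {Ω : Type*} {m : MeasurableSpace Ω}
    {μ : Measure Ω} {X : ℕ → Ω → ℝ} (hm : ∀ n, StronglyMeasurable (X n)) (hX : iIndepFun X μ)
    (h2 : ∀ n, MemLp (X n) 2 μ) (h0 : ∀ n, ∫ ω, X n ω ∂μ = 0)
    (hs : Summable fun n => Var[X n; μ]) :
    ∀ᵐ ω ∂μ, ∃ l, Tendsto (fun N => ∑ n ∈ Finset.range N, X n ω) atTop (𝓝 l) := by
  have : IsProbabilityMeasure μ := hX.isProbabilityMeasure
  have hint : ∀ n, Integrable (X n) μ := fun n => (h2 n).integrable one_le_two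
  -- The range `N + 1` includes `X N`, matching the natural filtration at time `N`.
  set M : ℕ → Ω → ℝ := fun N => ∑ n ∈ Finset.range (N + 1), X n with hM
  have hM2 : ∀ N, MemLp (M N) 2 μ := fun N => memLp_finsetSum' _ fun n _ => h2 n
  have hMint : ∀ N, Integrable (M N) μ := fun N => (hM2 N).integrable one_le_two
  have hM0 : ∀ N, ∫ ω, M N ω ∂μ = 0 := fun N => by
    simp only [hM, Finset.sum_apply]
    rw [integral_finsetSum _ fun n _ => hint n]
    simp [h0]
  have hadp : StronglyAdapted (Filtration.natural X hm) M := fun N =>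
    Finset.stronglyMeasurable_sum _ fun n hn =>
      (Filtration.stronglyAdapted_natural hm n).mono
        ((Filtration.natural X hm).mono (Nat.lt_succ_iff.1 (Finset.mem_range.1 hn)))
  have hmart : Martingale M (Filtration.natural X hm) μ := by
    refine martingale_nat hadp hMint fun N => ?_
    have hsplit : M (N + 1) = M N + X (N + 1) := Finset.sum_range_succ _ _
    rw [hsplit]
    filter_upwards [condExp_add (hMint N) (hint (N + 1)) (Filtration.natural X hm N),
      hX.condExp_natural_ae_eq_of_lt hm (Nat.lt_succ_self N)] with ω h₁ h₂
    rw [h₁, Pi.add_apply, h₂, h0, add_zero,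
      condExp_of_stronglyMeasurable ((Filtration.natural X hm).le N) (hadp N) (hMint N)]
  -- By `|t| ≤ t ^ 2 + 1`, bounded variances bound the `L¹` norms, as martingale convergence
  -- requires.
  have hbdd : ∀ N, eLpNorm (M N) 1 μ ≤ ((∑' n, Var[X n; μ]) + 1).toNNReal := fun N => by
    rw [eLpNorm_one_eq_lintegral_enorm, ← ofReal_integral_norm_eq_lintegral_enorm (hMint N)]
    refine ENNReal.ofReal_le_ofReal ?_
    have hsq : Integrable (fun ω => M N ω ^ 2) μ := (hM2 N).integrable_sq
    calc ∫ ω, ‖M N ω‖ ∂μ ≤ ∫ ω, (M N ω ^ 2 + 1) ∂μ := by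
          refine integral_mono (hMint N).norm (hsq.add (integrable_const _)) fun ω => ?_
          simp only [Real.norm_eq_abs]
          nlinarith [sq_abs (M N ω), sq_nonneg (|M N ω| - 1), sq_nonneg (|M N ω|)]
      _ = Var[M N; μ] + 1 := by
          rw [integral_add hsq (integrable_const _),
            variance_of_integral_eq_zero (hMint N).aemeasurable (hM0 N)]
          simp
      _ ≤ _ := by
          rw [hM, IndepFun.variance_sum (fun n _ => h2 n) fun i _ j _ hij => hX.indepFun hij]
          gcongr
          exact hs.sum_le_tsum _ fun n _ => variance_nonneg _ _
  filter_upwards [hmart.submartingale.exists_ae_tendsto_of_bdd hbdd] with ω ⟨l, hl⟩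
  refine ⟨l, (tendsto_add_atTop_iff_nat 1).1 ?_⟩
  simpa [hM] using hl

namespace BohrJessen

theorem integral_circleMeasure {E : Type*} [NormedAddCommGroup E] [NormedSpace ℝ E]
    {f : Circle → E} (hf : StronglyMeasurable f) :
    ∫ z, f z ∂circleMeasure =
      (2 * Real.pi)⁻¹ • ∫ θ in (0 : ℝ)..(2 * Real.pi), f (Circle.exp θ) := by
  rw [circleMeasure, integral_map Circle.exp.continuous.measurable.aemeasurable
    hf.aestronglyMeasurable, integral_smul_measure, ENNReal.toReal_inv,
    ENNReal.toReal_ofReal Real.two_pi_pos.le,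
    intervalIntegral.integral_of_le Real.two_pi_pos.le, integral_Ico_eq_integral_Ioc]

/-- The summand `-log (1 - a z)` as a function of the point `z` of the unit circle. -/
noncomputable def logTerm (a : ℝ) (z : Circle) : ℂ := -Complex.log (1 - (a : ℂ) * (z : ℂ))

theorem measurable_logTerm (a : ℝ) : Measurable (logTerm a) := by
  have : Measurable fun z : Circle => 1 - (a : ℂ) * (z : ℂ) :=
    Continuous.measurable (by fun_prop)
  exact (Complex.measurable_log.comp this).neg

/-- The threshold `3 / 4` exceeds `2 ^ (-1/2)`, so every `p ^ (-σ)` with `σ > 1/2` is covered. -/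
theorem norm_logTerm_le {a : ℝ} (h0 : 0 ≤ a) (ha : a ≤ 3 / 4) (z : Circle) :
    ‖logTerm a z‖ ≤ 3 * a := by
  have hn : ‖-((a : ℂ) * (z : ℂ))‖ = a := by
    simp [Circle.norm_coe, abs_of_nonneg h0]
  have h := Complex.norm_log_one_add_le (z := -((a : ℂ) * (z : ℂ))) (by rw [hn]; linarith)
  rw [hn] at h
  rw [logTerm, norm_neg, sub_eq_add_neg]
  refine h.trans ?_
  have h4 : (1 - a)⁻¹ ≤ 4 := by
    rw [inv_le_comm₀ (by linarith) (by norm_num)]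
    linarith
  have : a ^ 2 * (1 - a)⁻¹ ≤ a ^ 2 * 4 := by gcongr
  nlinarith

theorem logTerm_im (a : ℝ) (z : Circle) :
    (logTerm a z).im = -Complex.arg (1 - (a : ℂ) * (z : ℂ)) := by
  simp [logTerm, Complex.log_im]

theorem integrable_logTerm {a : ℝ} (h0 : 0 ≤ a) (ha : a ≤ 3 / 4) :
    Integrable (logTerm a) circleMeasure :=
  Integrable.of_bound (measurable_logTerm a).aestronglyMeasurable (3 * a)
    (ae_of_all _ (norm_logTerm_le h0 ha))

theorem one_sub_mem_slitPlane {w : ℂ} (hw : ‖w‖ < 1) : 1 - w ∈ Complex.slitPlane := by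
  rw [sub_eq_add_neg]
  exact Complex.mem_slitPlane_of_norm_lt_one (by simpa using hw)

/-- Mean value property: `-log (1 - a w)` is holomorphic on the closed disc and vanishes at its
centre. -/
theorem integral_logTerm {a : ℝ} (h0 : 0 ≤ a) (ha : a < 1) :
    ∫ z, logTerm a z ∂circleMeasure = 0 := by
  rw [integral_circleMeasure (measurable_logTerm a).stronglyMeasurable]
  have hd : DifferentiableOn ℂ (fun w : ℂ => -Complex.log (1 - (a : ℂ) * w))
      (Metric.closedBall 0 1) := by
    intro w hw
    have hw' : ‖(a : ℂ) * w‖ < 1 := by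
      have : ‖w‖ ≤ 1 := by simpa using hw
      rw [norm_mul, Complex.norm_real, Real.norm_of_nonneg h0]
      nlinarith [norm_nonneg w]
    exact (((by fun_prop : DifferentiableAt ℂ (fun w : ℂ => 1 - (a : ℂ) * w) w).clog
      (one_sub_mem_slitPlane hw')).neg).differentiableWithinAt
  have hav := DiffContOnCl.circleAverage (f := fun w : ℂ => -Complex.log (1 - (a : ℂ) * w))
    (c := 0) (R := 1) (by
      rw [abs_one]
      exact (hd.mono (by rw [closure_ball _ one_ne_zero])).diffContOnCl)
  rw [Real.circleAverage_def] at hav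
  simpa [circleMap, logTerm, Circle.coe_exp] using hav

theorem primesLT_mono : Monotone primesLT := fun N M h p hp => by
  rw [mem_primesLT] at hp ⊢
  omega

theorem tendsto_primesLT : Tendsto primesLT atTop atTop :=
  tendsto_atTop_finset_of_monotone primesLT_mono fun p =>
    ⟨p + 1, (mem_primesLT _ p).2 (Nat.lt_succ_self _)⟩

/-- Passes to a series indexed by `ℕ`, the form in which Kolmogorov's theorem applies. -/
theorem sum_primesLT {E : Type*} [AddCommMonoid E] (f : Nat.Primes → E) (N : ℕ) :
    ∑ p ∈ primesLT N, f p =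
      ∑ k ∈ Finset.range (Nat.primeCounting' N),
        f ⟨Nat.nth Nat.Prime k, Nat.prime_nth_prime k⟩ := by
  symm
  refine Finset.sum_bij (fun k _ => ⟨Nat.nth Nat.Prime k, Nat.prime_nth_prime k⟩) ?_ ?_ ?_ ?_
  · intro k hk
    refine (mem_primesLT _ _).2 ?_
    exact Nat.nth_lt_of_lt_count (Finset.mem_range.1 hk)
  · intro i _ j _ h
    exact Nat.nth_injective Nat.infinite_setOfPred_prime (congrArg Subtype.val h)
  · intro p hp
    rw [mem_primesLT] at hp
    refine ⟨Nat.primeCounting' p, Finset.mem_range.2 ?_, ?_⟩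
    · exact Nat.count_strict_mono p.2 hp
    · exact Subtype.ext (Nat.nth_count p.2)
  · intros; rfl

instance isProbabilityMeasure_prodMeasure : IsProbabilityMeasure prodMeasure := by
  unfold prodMeasure
  infer_instance

theorem ae_exists_tendsto_sum_primesLT {g : Nat.Primes → Circle → ℝ}
    (hg : ∀ p, Measurable (g p)) {c : Nat.Primes → ℝ} (hc : ∀ p z, |g p z| ≤ c p)
    (h0 : ∀ p, ∫ z, g p z ∂circleMeasure = 0) (hs : Summable fun p => c p ^ 2) :
    ∀ᵐ ω ∂prodMeasure,
      ∃ l, Tendsto (fun N => ∑ p ∈ primesLT N, g p (ω p)) atTop (𝓝 l) := by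
  set q : ℕ → Nat.Primes := fun k => ⟨Nat.nth Nat.Prime k, Nat.prime_nth_prime k⟩
  have hq : Function.Injective q := fun i j h =>
    Nat.nth_injective Nat.infinite_setOfPred_prime (congrArg Subtype.val h)
  have hind : iIndepFun (fun p (ω : Omega) => g p (ω p)) prodMeasure := iIndepFun_infinitePi hg
  have hmeas : ∀ p, Measurable fun ω : Omega => g p (ω p) := fun p =>
    (hg p).comp (measurable_pi_apply p)
  have hL : ∀ p, MemLp (fun ω : Omega => g p (ω p)) 2 prodMeasure := fun p =>
    MemLp.of_bound (hmeas p).aestronglyMeasurable (c p) (ae_of_all _ fun ω => hc p _)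
  have hvar : ∀ p, Var[fun ω : Omega => g p (ω p); prodMeasure] ≤ c p ^ 2 := fun p => by
    refine (variance_le_expectation_sq (hmeas p).aestronglyMeasurable).trans ?_
    calc _ ≤ ∫ _ω : Omega, c p ^ 2 ∂prodMeasure := by
          refine integral_mono (hL p).integrable_sq (integrable_const _) fun ω => ?_
          exact sq_le_sq' (abs_le.1 (hc p (ω p))).1 (abs_le.1 (hc p (ω p))).2
      _ = _ := by simp
  have := ae_exists_tendsto_sum_of_summable_variance (X := fun k (ω : Omega) => g (q k) (ω (q k)))
    (fun k => (hmeas _).stronglyMeasurable) (hind.precomp hq) (fun k => hL _)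
    (fun k => by
      rw [← h0 (q k)]
      have he := Measure.infinitePi_map_eval (fun _ : Nat.Primes => circleMeasure) (q k)
      conv_rhs => rw [← he]
      rw [integral_map (measurable_pi_apply _).aemeasurable (hg _).aestronglyMeasurable]
      rfl)
    (Summable.of_nonneg_of_le (fun _ => variance_nonneg _ _) (fun k => hvar (q k))
      (hs.comp_injective hq))
  filter_upwards [this] with ω ⟨l, hl⟩
  refine ⟨l, ?_⟩
  simp_rw [sum_primesLT]
  exact hl.comp Nat.tendsto_primeCounting'

end BohrJessen

/-! ### Gaussian means of characteristic functions. -/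

theorem integral_charFun_comm {μ ν : Measure ℝ} [IsProbabilityMeasure μ]
    [IsProbabilityMeasure ν] : ∫ x, charFun μ x ∂ν = ∫ u, charFun ν u ∂μ := by
  simp only [charFun_apply_real]
  rw [integral_integral_swap]
  · simp only [mul_comm]
  · refine Integrable.of_bound (C := 1) ?_ (ae_of_all _ fun z => ?_)
    · refine Continuous.aestronglyMeasurable ?_
      fun_prop
    · simp only [Function.uncurry]
      rw [← Complex.ofReal_mul, Complex.norm_exp_ofReal_mul_I]

theorem integral_charFun_gaussianReal {μ : Measure ℝ} [IsProbabilityMeasure μ] (v : NNReal) :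
    ∫ x, charFun μ x ∂(gaussianReal 0 v) = ((∫ u, Real.exp (-(v * u ^ 2 / 2)) ∂μ : ℝ) : ℂ) := by
  rw [integral_charFun_comm, ← integral_complex_ofReal]
  refine integral_congr_ae (ae_of_all _ fun u => ?_)
  simp [charFun_gaussianReal]

theorem gaussianReal_real_Icc_le {x₀ : ℝ} (hx : 0 ≤ x₀) {v : NNReal} (hv : v ≠ 0) :
    (gaussianReal 0 v).real (Set.Icc (-x₀) x₀) ≤ 2 * x₀ / √v := by
  have hv' : (0 : ℝ) < v := by positivity
  rw [measureReal_def, gaussianReal_apply_eq_integral 0 hv]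
  rw [ENNReal.toReal_ofReal (integral_nonneg fun x => gaussianPDFReal_nonneg _ _ _)]
  have hpdf : ∀ x, ‖gaussianPDFReal 0 v x‖ ≤ (√v)⁻¹ := fun x => by
    rw [Real.norm_of_nonneg (gaussianPDFReal_nonneg _ _ _), gaussianPDFReal_def]
    have h1 : √(v : ℝ) ≤ √(2 * Real.pi * v) := by
      refine Real.sqrt_le_sqrt ?_
      nlinarith [Real.pi_gt_three]
    have h2 : Real.exp (-(x - 0) ^ 2 / (2 * v)) ≤ 1 := by
      rw [Real.exp_le_one_iff]
      exact div_nonpos_of_nonpos_of_nonneg (neg_nonpos.2 (sq_nonneg _)) (by positivity)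
    exact (mul_le_mul (inv_anti₀ (Real.sqrt_pos.2 hv') h1) h2 (Real.exp_pos _).le
      (by positivity)).trans_eq (mul_one _)
  refine (Real.le_norm_self _).trans ((norm_setIntegral_le_of_norm_le_const (C := (√v)⁻¹)
    (by simp) fun x _ => hpdf x).trans_eq ?_)
  rw [Real.volume_real_Icc_of_le (by linarith)]
  ring

theorem norm_charFun_map_sub (μ : Measure ℝ) [IsProbabilityMeasure μ] (u₀ x : ℝ) :
    ‖charFun (μ.map fun u => u - u₀) x‖ = ‖charFun μ x‖ := by
  have : charFun (μ.map fun u => u - u₀) x =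
      Complex.exp (-(x * u₀ : ℝ) * Complex.I) * charFun μ x := by
    rw [charFun_apply_real, charFun_apply_real, integral_map (by fun_prop) (by fun_prop),
      ← integral_const_mul]
    refine integral_congr_ae (ae_of_all _ fun u => ?_)
    simp only
    rw [← Complex.exp_add]
    congr 1
    push_cast
    ring
  rw [this, norm_mul, ← Complex.ofReal_neg, Complex.norm_exp_ofReal_mul_I, one_mul]

/-- A symmetric law whose characteristic function has finitely many zeros and that has bounded
density at the origin (in the Gaussian mean) has bounded density at every point. -/
theorem exists_gaussian_mean_le_of_finite_zeros {μ : Measure ℝ} [IsProbabilityMeasure μ]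
    (hre : ∀ x, ((charFun μ x).re : ℂ) = charFun μ x) (hfin : {x | charFun μ x = 0}.Finite) {C : ℝ}
    (hC : ∀ v : NNReal, v ≠ 0 → ∫ u, Real.exp (-(v * u ^ 2 / 2)) ∂μ ≤ C / √v) (u₀ : ℝ) :
    ∃ C', ∀ v : NNReal, v ≠ 0 → ∫ u, Real.exp (-(v * (u - u₀) ^ 2 / 2)) ∂μ ≤ C' / √v := by
  have hcont : Continuous fun x => (charFun μ x).re := Complex.continuous_re.comp continuous_charFun
  obtain ⟨x₀, hx₀, hz⟩ : ∃ x₀ : ℝ, 0 ≤ x₀ ∧ ∀ x, x₀ < x → (charFun μ x).re ≠ 0 := by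
    obtain ⟨B, hB⟩ := hfin.bddAbove
    refine ⟨max B 0, le_max_right _ _, fun x hx h => ?_⟩
    have : x ≤ B := hB (by rw [Set.mem_ofPred_eq, ← hre x, h]; simp)
    exact absurd (this.trans (le_max_left B 0)) (not_le.2 hx)
  have heven : ∀ x, (charFun μ (-x)).re = (charFun μ x).re := fun x => by simp [charFun_neg]
  -- Having no zero beyond `x₀`, the real part keeps one sign there, by the intermediate value
  -- theorem.
  obtain ⟨ε, hε, hsign⟩ : ∃ ε : ℝ, |ε| = 1 ∧ ∀ x, x₀ < x → 0 ≤ ε * (charFun μ x).re := by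
    by_cases hpos : ∀ x, x₀ < x → 0 ≤ (charFun μ x).re
    · exact ⟨1, by simp, fun x hx => by simpa using hpos x hx⟩
    · push Not at hpos
      obtain ⟨y, hy, hyneg⟩ := hpos
      refine ⟨-1, by simp, fun x hx => ?_⟩
      by_contra! hlt
      obtain ⟨t, ht, ht0⟩ := (isPreconnected_Ioi (a := x₀)).intermediate_value hy hx
        hcont.continuousOn (show (0 : ℝ) ∈ Set.Icc _ _ from ⟨hyneg.le, by linarith⟩)
      exact hz t ht ht0
  have hnorm : ∀ x, ‖charFun μ x‖ = |(charFun μ x).re| := fun x => by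
    conv_lhs => rw [← hre x]
    simp
  have habs : ∀ x, ‖charFun μ x‖ ≤
      ε * (charFun μ x).re + (Set.Icc (-x₀) x₀).indicator (fun _ => (2 : ℝ)) x := fun x => by
    have he : |ε * (charFun μ x).re| = ‖charFun μ x‖ := by rw [abs_mul, hε, one_mul, hnorm]
    by_cases hx : x ∈ Set.Icc (-x₀) x₀
    · rw [Set.indicator_of_mem hx]
      have h1 : ‖charFun μ x‖ ≤ 1 := norm_charFun_le_one x
      have := neg_abs_le (ε * (charFun μ x).re)
      linarith
    · rw [Set.indicator_of_notMem hx, add_zero, ← he, abs_of_nonneg]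
      rcases lt_or_ge x₀ x with h | h
      · exact hsign x h
      · rw [← heven]
        refine hsign _ ?_
        by_contra! h'
        exact hx ⟨by linarith, h⟩
  -- `4 * x₀` is the indicator's height `2` times the bound `2 * x₀ / √v` for the Gaussian mass of
  -- `[-x₀, x₀]`.
  refine ⟨C + 4 * x₀, fun v hv => ?_⟩
  have hint : Integrable (charFun μ) (gaussianReal 0 v) :=
    Integrable.of_bound continuous_charFun.aestronglyMeasurable 1
      (ae_of_all _ norm_charFun_le_one)
  have hshift : ∫ u, Real.exp (-(v * (u - u₀) ^ 2 / 2)) ∂μ ≤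
      ∫ x, ‖charFun μ x‖ ∂(gaussianReal 0 v) := by
    have : IsProbabilityMeasure (μ.map fun u => u - u₀) :=
      Measure.isProbabilityMeasure_map (by fun_prop)
    have h := integral_charFun_gaussianReal (μ := μ.map fun u => u - u₀) v
    rw [integral_map (by fun_prop) (by fun_prop)] at h
    calc _ ≤ ‖((∫ u, Real.exp (-(v * (u - u₀) ^ 2 / 2)) ∂μ : ℝ) : ℂ)‖ := by
          rw [Complex.norm_real]
          exact Real.le_norm_self _
      _ ≤ _ := by
          rw [← h]
          refine (norm_integral_le_integral_norm _).trans_eq ?_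
          simp only [norm_charFun_map_sub]
  refine hshift.trans ?_
  have hreint : Integrable (fun x => ε * (charFun μ x).re) (gaussianReal 0 v) :=
    hint.re.const_mul ε
  have hind : Integrable ((Set.Icc (-x₀) x₀).indicator fun _ => (2 : ℝ)) (gaussianReal 0 v) :=
    (integrable_const _).indicator measurableSet_Icc
  refine (integral_mono hint.norm (hreint.add hind) habs).trans ?_
  rw [integral_add' hreint hind, integral_const_mul, integral_indicator_const _ measurableSet_Icc]
  have hmean : ∫ x, (charFun μ x).re ∂(gaussianReal 0 v) =
      ∫ u, Real.exp (-(v * u ^ 2 / 2)) ∂μ := by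
    have := congrArg Complex.re (integral_charFun_gaussianReal (μ := μ) v)
    rw [Complex.ofReal_re] at this
    rw [← this]
    exact integral_re hint
  have hnn : 0 ≤ ∫ u, Real.exp (-(v * u ^ 2 / 2)) ∂μ :=
    integral_nonneg fun u => (Real.exp_pos _).le
  have h1 : ε * ∫ u, Real.exp (-(v * u ^ 2 / 2)) ∂μ ≤ C / √v := by
    refine le_trans ?_ (hC v hv)
    have : ε ≤ 1 := hε ▸ le_abs_self ε
    nlinarith
  rw [hmean, add_div]
  refine add_le_add h1 ?_
  rw [smul_eq_mul]
  calc _ ≤ 2 * x₀ / √v * 2 := by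
        gcongr
        exact gaussianReal_real_Icc_le hx₀ hv
    _ = _ := by ring

namespace BohrJessen

/-! ### The law of a single argument and the zeros of its characteristic function. -/

/-- The law of `-arg (1 - a z)`, `z` uniform on the unit circle. -/
noncomputable def argLaw (a : ℝ) : Measure ℝ := circleMeasure.map fun z => (logTerm a z).im

theorem measurable_logTerm_im (a : ℝ) : Measurable fun z => (logTerm a z).im :=
  Complex.measurable_im.comp (measurable_logTerm a)

instance isProbabilityMeasure_argLaw (a : ℝ) : IsProbabilityMeasure (argLaw a) :=
  Measure.isProbabilityMeasure_map (measurable_logTerm_im a).aemeasurable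

theorem integral_argLaw {E : Type*} [NormedAddCommGroup E] [NormedSpace ℝ E] (a : ℝ)
    {f : ℝ → E} (hf : StronglyMeasurable f) :
    ∫ u, f u ∂argLaw a = (2 * Real.pi)⁻¹ •
      ∫ θ in (0 : ℝ)..(2 * Real.pi), f (logTerm a (Circle.exp θ)).im := by
  rw [argLaw, integral_map (measurable_logTerm_im a).aemeasurable hf.aestronglyMeasurable]
  exact integral_circleMeasure (hf.comp_measurable (measurable_logTerm_im a))

theorem charFun_argLaw (b x : ℝ) : charFun (argLaw b⁻¹) x = I b x := by
  rw [charFun_apply_real, integral_argLaw _ (Continuous.stronglyMeasurable (by fun_prop)), I,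
    Complex.real_smul]
  push_cast
  rw [one_div]
  congr 1
  refine intervalIntegral.integral_congr fun θ _ => ?_
  simp only [logTerm_im, Circle.coe_exp]
  congr 1
  push_cast
  rw [mul_comm Complex.I (θ : ℂ)]
  ring

/-- Conjugation symmetry makes the law symmetric, hence its characteristic function real. -/
theorem logTerm_conj_im {a : ℝ} (h0 : 0 ≤ a) (ha : a < 1) (z : Circle) :
    (logTerm a z⁻¹).im = -(logTerm a z).im := by
  have hs : 1 - (a : ℂ) * (z : ℂ) ∈ Complex.slitPlane := one_sub_mem_slitPlane (by
    rw [norm_mul, Complex.norm_real, Circle.norm_coe, mul_one, Real.norm_of_nonneg h0]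
    exact ha)
  rw [logTerm_im, logTerm_im, neg_neg, Circle.coe_inv_eq_conj]
  have : 1 - (a : ℂ) * (starRingEnd ℂ) (z : ℂ) = (starRingEnd ℂ) (1 - (a : ℂ) * z) := by simp
  rw [this, Complex.arg_conj, if_neg (Complex.slitPlane_arg_ne_pi hs), neg_neg]

theorem charFun_argLaw_re {a : ℝ} (h0 : 0 ≤ a) (ha : a < 1) (x : ℝ) :
    ((charFun (argLaw a) x).re : ℂ) = charFun (argLaw a) x := by
  rw [← Complex.conj_eq_iff_re, ← charFun_neg]
  rw [charFun_apply_real, charFun_apply_real,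
    integral_argLaw _ (Continuous.stronglyMeasurable (by fun_prop)),
    integral_argLaw _ (Continuous.stronglyMeasurable (by fun_prop))]
  congr 1
  have := intervalIntegral.integral_comp_sub_left (a := 0) (b := 2 * Real.pi)
    (fun θ => Complex.exp (x * (logTerm a (Circle.exp θ)).im * Complex.I)) (2 * Real.pi)
  rw [sub_self, sub_zero] at this
  rw [← this]
  refine intervalIntegral.integral_congr fun θ _ => ?_
  have he : Circle.exp (2 * Real.pi - θ) = (Circle.exp θ)⁻¹ := by
    rw [Circle.exp_sub, Circle.exp_two_pi, one_div]
  rw [he, logTerm_conj_im h0 ha]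
  push_cast
  ring_nf

/-- For `w = 1 - a e^{iθ}`, `a |sin θ| = |Im w| = ‖w‖ |sin (arg w)| ≤ 2 |arg w|`. The angle is thus
small only near multiples of `π`. -/
theorem mul_abs_sin_le_abs_logTerm_im {a : ℝ} (h0 : 0 < a) (ha : a < 1) (θ : ℝ) :
    a / 2 * |Real.sin θ| ≤ |(logTerm a (Circle.exp θ)).im| := by
  set w : ℂ := 1 - (a : ℂ) * (Circle.exp θ : ℂ) with hw
  have hn : ‖w‖ ≤ 2 := by
    refine (norm_sub_le _ _).trans ?_
    rw [norm_mul, Complex.norm_real, Circle.norm_coe, mul_one, Real.norm_of_nonneg h0.le,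
      norm_one]
    linarith
  have him : w.im = -(a * Real.sin θ) := by
    simp [hw, Circle.coe_exp, Complex.exp_ofReal_mul_I_im]
  rw [logTerm_im, abs_neg]
  have h1 : |w.im| = ‖w‖ * |Real.sin w.arg| := by
    rw [← Complex.norm_mul_sin_arg, abs_mul, abs_norm]
  have h2 : |Real.sin w.arg| ≤ |w.arg| := Real.abs_sin_le_abs
  rw [him, abs_neg, abs_mul, abs_of_pos h0] at h1
  have : ‖w‖ * |Real.sin w.arg| ≤ 2 * |w.arg| := by gcongr
  linarith

/-- Jordan's inequality at the nearest zero of the sine; on `[0, 2π]` these are `0`, `π`, `2π`. -/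
theorem exp_neg_mul_sin_sq_le {w : ℝ} (hw : 0 ≤ w) {θ : ℝ}
    (hθ : θ ∈ Set.Icc 0 (2 * Real.pi)) :
    Real.exp (-w * Real.sin θ ^ 2) ≤
      ∑ k ∈ Finset.range 3, Real.exp (-(w * (2 / Real.pi) ^ 2) * (θ - k * Real.pi) ^ 2) := by
  have hpi := Real.pi_pos
  obtain ⟨k, hk, hkθ⟩ : ∃ k ∈ Finset.range 3, |θ - (k : ℕ) * Real.pi| ≤ Real.pi / 2 := by
    rcases le_total θ (Real.pi / 2) with h | h
    · exact ⟨0, by simp, by rw [abs_le]; constructor <;> push_cast <;> linarith [hθ.1]⟩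
    rcases le_total θ (3 * Real.pi / 2) with h' | h'
    · exact ⟨1, by simp, by rw [abs_le]; constructor <;> push_cast <;> linarith⟩
    · exact ⟨2, by simp, by rw [abs_le]; constructor <;> push_cast <;> linarith [hθ.2]⟩
  refine le_trans ?_ (Finset.single_le_sum (fun i _ => (Real.exp_pos _).le) hk)
  have hsin : Real.sin θ ^ 2 = Real.sin (θ - k * Real.pi) ^ 2 := by
    rw [Real.sin_sub_nat_mul_pi, mul_pow, ← pow_mul, mul_comm k 2, pow_mul]
    simp
  have h := Real.mul_abs_le_abs_sin hkθ
  have h2 : (2 / Real.pi) ^ 2 * (θ - k * Real.pi) ^ 2 ≤ Real.sin θ ^ 2 := by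
    rw [hsin, ← sq_abs (Real.sin _), ← sq_abs (θ - _), ← mul_pow]
    gcongr
  refine Real.exp_le_exp.2 ?_
  nlinarith [mul_le_mul_of_nonneg_left h2 hw]

theorem integral_exp_neg_mul_sin_sq_le {w : ℝ} (hw : 0 < w) :
    ∫ θ in (0 : ℝ)..(2 * Real.pi), Real.exp (-w * Real.sin θ ^ 2) ≤
      3 * √(Real.pi / (w * (2 / Real.pi) ^ 2)) := by
  have hc : 0 < w * (2 / Real.pi) ^ 2 := by positivity
  have hint : ∀ k : ℕ, Integrable fun θ : ℝ =>
      Real.exp (-(w * (2 / Real.pi) ^ 2) * (θ - k * Real.pi) ^ 2) := fun k =>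
    (integrable_exp_neg_mul_sq hc).comp_sub_right _
  calc _ ≤ ∫ θ in (0 : ℝ)..(2 * Real.pi),
        ∑ k ∈ Finset.range 3, Real.exp (-(w * (2 / Real.pi) ^ 2) * (θ - k * Real.pi) ^ 2) :=
        intervalIntegral.integral_mono_on Real.two_pi_pos.le
          (Continuous.intervalIntegrable (by fun_prop) _ _)
          (Continuous.intervalIntegrable (by fun_prop) _ _)
          fun θ hθ => exp_neg_mul_sin_sq_le hw.le hθ
    _ ≤ ∫ θ : ℝ,
        ∑ k ∈ Finset.range 3, Real.exp (-(w * (2 / Real.pi) ^ 2) * (θ - k * Real.pi) ^ 2) := by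
        rw [intervalIntegral.integral_of_le Real.two_pi_pos.le]
        exact setIntegral_le_integral (integrable_finsetSum _ fun k _ => hint k)
          (ae_of_all _ fun θ => Finset.sum_nonneg fun k _ => (Real.exp_pos _).le)
    _ = _ := by
        rw [integral_finsetSum _ fun k _ => hint k]
        have : ∀ k ∈ Finset.range 3, ∫ θ : ℝ,
            Real.exp (-(w * (2 / Real.pi) ^ 2) * (θ - k * Real.pi) ^ 2) =
              √(Real.pi / (w * (2 / Real.pi) ^ 2)) := fun k _ => by
          rw [integral_sub_right_eq_self
            (fun θ : ℝ => Real.exp (-(w * (2 / Real.pi) ^ 2) * θ ^ 2)), integral_gaussian]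
        rw [Finset.sum_congr rfl this]
        simp

theorem logTerm_im_continuous {a : ℝ} (h0 : 0 ≤ a) (ha : a < 1) :
    Continuous fun θ : ℝ => (logTerm a (Circle.exp θ)).im := by
  refine Complex.continuous_im.comp (Continuous.neg (Continuous.clog (by fun_prop) fun θ => ?_))
  refine one_sub_mem_slitPlane ?_
  rw [norm_mul, Complex.norm_real, Circle.norm_coe, mul_one, Real.norm_of_nonneg h0]
  exact ha

theorem gaussian_mean_argLaw_le {a : ℝ} (h0 : 0 < a) (ha : a < 1) {v : NNReal} (hv : v ≠ 0) :
    ∫ u, Real.exp (-(v * u ^ 2 / 2)) ∂argLaw a ≤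
      (2 * Real.pi)⁻¹ * (3 * √(Real.pi / (a ^ 2 / 8 * (2 / Real.pi) ^ 2))) / √v := by
  have hv' : (0 : ℝ) < v := by positivity
  rw [integral_argLaw _ (Continuous.stronglyMeasurable (by fun_prop)), smul_eq_mul, mul_div_assoc]
  refine mul_le_mul_of_nonneg_left ?_ (by positivity)
  -- `a ^ 2 / 8` is half the square of the constant `a / 2` in the sine bound.
  calc _ ≤ ∫ θ in (0 : ℝ)..(2 * Real.pi), Real.exp (-(v * (a ^ 2 / 8)) * Real.sin θ ^ 2) := by
        refine intervalIntegral.integral_mono_on Real.two_pi_pos.le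
          (Continuous.intervalIntegrable ?_ _ _) (Continuous.intervalIntegrable (by fun_prop) _ _)
          fun θ _ => ?_
        · have := logTerm_im_continuous h0.le ha
          fun_prop
        · refine Real.exp_le_exp.2 ?_
          have h := mul_abs_sin_le_abs_logTerm_im h0 ha θ
          have h2 := pow_le_pow_left₀ (by positivity) h 2
          rw [mul_pow, sq_abs, sq_abs] at h2
          nlinarith [mul_le_mul_of_nonneg_left h2 hv'.le]
    _ ≤ _ := by
        refine (integral_exp_neg_mul_sin_sq_le (by positivity)).trans_eq ?_
        rw [mul_div_assoc, ← Real.sqrt_div' _ hv'.le]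
        congr 2
        field_simp

theorem hasDerivAt_logTerm_im {a : ℝ} (h0 : 0 ≤ a) (ha : a < 1) (θ : ℝ) :
    HasDerivAt (fun θ : ℝ => (logTerm a (Circle.exp θ)).im)
      (a * (Real.cos θ - a) / Complex.normSq (1 - (a : ℂ) * Complex.exp (θ * Complex.I))) θ := by
  have hs : 1 - (a : ℂ) * Complex.exp (θ * Complex.I) ∈ Complex.slitPlane :=
    one_sub_mem_slitPlane (by
      rw [norm_mul, Complex.norm_real, Complex.norm_exp_ofReal_mul_I, mul_one,
        Real.norm_of_nonneg h0]
      exact ha)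
  have h1 : HasDerivAt (fun θ : ℝ => Complex.exp (θ * Complex.I))
      (Complex.exp (θ * Complex.I) * Complex.I) θ := by
    simpa using ((hasDerivAt_id θ).ofReal_comp.mul_const Complex.I).cexp
  have h2 := (((h1.const_mul (a : ℂ)).const_sub 1).clog_real hs).neg
  have h3 := Complex.imCLM.hasFDerivAt.comp_hasDerivAt θ h2
  refine h3.congr_deriv ?_
  have him : ∀ z : ℂ, Complex.imCLM z = z.im := fun z => rfl
  have hsc := Real.sin_sq_add_cos_sq θ
  rw [him, Complex.neg_im, Complex.div_im]
  simp only [Complex.sub_re, Complex.sub_im, Complex.neg_re, Complex.neg_im, Complex.mul_re,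
    Complex.mul_im, Complex.ofReal_re, Complex.ofReal_im, Complex.I_re, Complex.I_im,
    Complex.one_re, Complex.one_im, Complex.exp_ofReal_mul_I_re, Complex.exp_ofReal_mul_I_im]
  rw [← sub_div, ← neg_div]
  congr 1
  linear_combination -a ^ 2 * hsc

/-- The derivative vanishes at `arccos a` and is at most `a / (1 - a) ^ 2 * s` within distance `s`,
since cosine is 1-Lipschitz and `|1 - a e^{it}| ≥ 1 - a`. Hence the deviation is quadratic in `s`.
-/
theorem abs_logTerm_im_sub_le {a : ℝ} (h0 : 0 < a) (ha : a < 1) {s θ : ℝ} (hs : 0 ≤ s)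
    (hθ : θ ∈ Set.Icc (Real.arccos a) (Real.arccos a + s)) :
    |(logTerm a (Circle.exp θ)).im - (logTerm a (Circle.exp (Real.arccos a))).im| ≤
      a / (1 - a) ^ 2 * s ^ 2 := by
  have hb : ∀ t ∈ Set.Icc (Real.arccos a) (Real.arccos a + s),
      ‖a * (Real.cos t - a) / Complex.normSq (1 - (a : ℂ) * Complex.exp (t * Complex.I))‖ ≤
        a / (1 - a) ^ 2 * s := fun t ht => by
    have hc : |Real.cos t - a| ≤ s := by
      have := Real.abs_cos_sub_cos_le t (Real.arccos a)
      rw [Real.cos_arccos (by linarith) ha.le] at this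
      refine this.trans ?_
      rw [abs_le]
      constructor <;> linarith [ht.1, ht.2]
    have hn : (1 - a) ^ 2 ≤ Complex.normSq (1 - (a : ℂ) * Complex.exp (t * Complex.I)) := by
      rw [Complex.normSq_eq_norm_sq]
      have := norm_sub_norm_le (1 : ℂ) ((a : ℂ) * Complex.exp (t * Complex.I))
      rw [norm_mul, Complex.norm_real, Complex.norm_exp_ofReal_mul_I, mul_one, norm_one,
        Real.norm_of_nonneg h0.le] at this
      exact pow_le_pow_left₀ (by linarith) this 2
    have hpos : 0 < (1 - a) ^ 2 := by
      have : 0 < 1 - a := by linarith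
      positivity
    rw [Real.norm_eq_abs, abs_div, abs_mul, abs_of_pos h0, abs_of_pos (hpos.trans_le hn),
      div_mul_eq_mul_div]
    gcongr
  have h := Convex.norm_image_sub_le_of_norm_hasDerivWithin_le
    (fun t _ => (hasDerivAt_logTerm_im h0.le ha t).hasDerivWithinAt) hb
    (convex_Icc (Real.arccos a) (Real.arccos a + s)) (Set.left_mem_Icc.2 (by linarith)) hθ
  rw [Real.norm_eq_abs, Real.norm_eq_abs] at h
  refine h.trans ?_
  have hd : |θ - Real.arccos a| ≤ s := by
    rw [abs_le]
    constructor <;> linarith [hθ.1, hθ.2]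
  calc _ ≤ a / (1 - a) ^ 2 * s * s := by gcongr
    _ = _ := by ring

/-- With `v = s ^ (-4)`, the quadratic deviation keeps the exponent bounded on a window of length
`s`, so the mean is at least of order `s = v ^ (-1/4)`. -/
theorem le_gaussian_mean_argLaw {a : ℝ} (h0 : 0 < a) (ha : a < 1) {s : ℝ} (hs : 0 ≤ s)
    (hs1 : s ≤ 1) {v : NNReal} (hv : v * s ^ 4 = 1) :
    (2 * Real.pi)⁻¹ * (s * Real.exp (-((a / (1 - a) ^ 2) ^ 2 / 2))) ≤
      ∫ u, Real.exp
        (-(v * (u - (logTerm a (Circle.exp (Real.arccos a))).im) ^ 2 / 2)) ∂argLaw a := by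
  rw [integral_argLaw _ (Continuous.stronglyMeasurable (by fun_prop)), smul_eq_mul]
  refine mul_le_mul_of_nonneg_left ?_ (by positivity)
  set u₀ := (logTerm a (Circle.exp (Real.arccos a))).im
  have hcont : Continuous fun θ : ℝ =>
      Real.exp (-(v * ((logTerm a (Circle.exp θ)).im - u₀) ^ 2 / 2)) := by
    have := logTerm_im_continuous h0.le ha
    fun_prop
  have hle : Real.arccos a ≤ Real.pi / 2 := Real.arccos_le_pi_div_two.2 h0.le
  calc s * Real.exp (-((a / (1 - a) ^ 2) ^ 2 / 2))
      = ∫ _θ in (Real.arccos a)..(Real.arccos a + s),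
          Real.exp (-((a / (1 - a) ^ 2) ^ 2 / 2)) := by simp
    _ ≤ ∫ θ in (Real.arccos a)..(Real.arccos a + s),
          Real.exp (-(v * ((logTerm a (Circle.exp θ)).im - u₀) ^ 2 / 2)) := by
        refine intervalIntegral.integral_mono_on (by linarith)
          (Continuous.intervalIntegrable (by fun_prop) _ _) (hcont.intervalIntegrable _ _)
          fun θ hθ => Real.exp_le_exp.2 ?_
        have h := pow_le_pow_left₀ (abs_nonneg _) (abs_logTerm_im_sub_le h0 ha hs hθ) 2
        rw [sq_abs, mul_pow, ← pow_mul] at h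
        have h2 := mul_le_mul_of_nonneg_left h v.coe_nonneg
        have h3 : (v : ℝ) * ((a / (1 - a) ^ 2) ^ 2 * s ^ (2 * 2)) = (a / (1 - a) ^ 2) ^ 2 := by
          linear_combination (a / (1 - a) ^ 2) ^ 2 * hv
        rw [h3] at h2
        linarith
    _ ≤ _ := by
        -- The window lies in `[0, 2π]` because `arccos a ≤ π / 2` and `s ≤ 1`.
        refine intervalIntegral.integral_mono_interval (Real.arccos_nonneg a) (by linarith)
          (by linarith [Real.pi_gt_three]) (ae_of_all _ fun θ => (Real.exp_pos _).le)
          (hcont.intervalIntegrable _ _)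

theorem infinite_zeros_charFun_argLaw {a : ℝ} (h0 : 0 < a) (ha : a < 1) :
    {x | charFun (argLaw a) x = 0}.Infinite := by
  intro hfin
  obtain ⟨C, hC⟩ := exists_gaussian_mean_le_of_finite_zeros (charFun_argLaw_re h0.le ha) hfin
    (fun v hv => gaussian_mean_argLaw_le h0 ha hv) (logTerm a (Circle.exp (Real.arccos a))).im
  set c := (2 * Real.pi)⁻¹ * Real.exp (-((a / (1 - a) ^ 2) ^ 2 / 2)) with hc
  have hcpos : 0 < c := by positivity
  -- For `v = s ^ (-4)` the lower bound is `c * s` and the upper bound `C / √v = C * s ^ 2`; this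
  -- fails as `s → 0`.
  have key : ∀ s : ℝ, 0 < s → s ≤ 1 → c ≤ C * s := fun s hs hs1 => by
    have hv : (Real.toNNReal (s ^ 4)⁻¹ : ℝ) = (s ^ 4)⁻¹ := Real.coe_toNNReal _ (by positivity)
    have h1 := le_gaussian_mean_argLaw h0 ha hs.le hs1 (v := Real.toNNReal (s ^ 4)⁻¹)
      (by rw [hv]; field_simp)
    have h2 := h1.trans (hC _ (by rw [Ne, Real.toNNReal_eq_zero, not_le]; positivity))
    have hsq : √((s ^ 4)⁻¹) = (s ^ 2)⁻¹ := by
      rw [Real.sqrt_inv, show s ^ 4 = (s ^ 2) ^ 2 by ring, Real.sqrt_sq (by positivity)]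
    rw [hv, hsq, div_inv_eq_mul] at h2
    have h3 : c * s ≤ C * s * s := by
      rw [hc]
      linarith
    exact le_of_mul_le_mul_right h3 hs
  have hCpos : 0 < C := by linarith [key 1 one_pos le_rfl]
  have hs : 0 < min 1 (c / (2 * C)) := by positivity
  have h1 := key _ hs (min_le_left _ _)
  have h2 : C * min 1 (c / (2 * C)) ≤ C * (c / (2 * C)) := by
    gcongr
    exact min_le_right _ _
  have h3 : C * (c / (2 * C)) = c / 2 := by field_simp
  linarith

/-! ### Convergence of `S` and the product formula. -/

theorem rpow_neg_sq (σ : ℝ) (p : Nat.Primes) :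
    (((p : ℕ) : ℝ) ^ (-σ)) ^ 2 = ((p : ℕ) : ℝ) ^ (-(2 * σ)) := by
  rw [← Real.rpow_natCast, ← Real.rpow_mul (Nat.cast_nonneg _)]
  congr 1
  push_cast
  ring

theorem rpow_neg_pos (σ : ℝ) (p : Nat.Primes) : 0 < ((p : ℕ) : ℝ) ^ (-σ) :=
  Real.rpow_pos_of_pos (Nat.cast_pos.2 p.2.pos) _

theorem rpow_neg_le {σ : ℝ} (hσ : 1 / 2 < σ) (p : Nat.Primes) :
    ((p : ℕ) : ℝ) ^ (-σ) ≤ 3 / 4 := by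
  have hp : (2 : ℝ) ≤ (p : ℕ) := by exact_mod_cast p.2.two_le
  have h : ((p : ℕ) : ℝ) ^ (-(2 * σ)) ≤ 1 / 2 := by
    calc ((p : ℕ) : ℝ) ^ (-(2 * σ)) ≤ ((p : ℕ) : ℝ) ^ (-1 : ℝ) :=
          Real.rpow_le_rpow_of_exponent_le (by linarith) (by linarith)
      _ = ((p : ℕ) : ℝ)⁻¹ := Real.rpow_neg_one _
      _ ≤ 1 / 2 := by
          rw [one_div]
          exact inv_anti₀ two_pos hp
  rw [← rpow_neg_sq] at h
  nlinarith

theorem summable_rpow_neg_sq {σ : ℝ} (hσ : 1 / 2 < σ) :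
    Summable fun p : Nat.Primes => (((p : ℕ) : ℝ) ^ (-σ)) ^ 2 := by
  simp_rw [rpow_neg_sq]
  exact Nat.Primes.summable_rpow.2 (by linarith)

theorem partialS_eq (σ : ℝ) (N : ℕ) (ω : Omega) :
    partialS σ N ω = ∑ p ∈ primesLT N, logTerm (((p : ℕ) : ℝ) ^ (-σ)) (ω p) := rfl

theorem measurable_partialS (σ : ℝ) (N : ℕ) : Measurable (partialS σ N) :=
  Finset.measurable_sum _ fun p _ => (measurable_logTerm _).comp (measurable_pi_apply p)

theorem measurable_S (σ : ℝ) : Measurable (S σ) :=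
  (StronglyMeasurable.limUnder fun N => (measurable_partialS σ N).stronglyMeasurable).measurable

theorem ae_tendsto_partialS {σ : ℝ} (hσ : 1 / 2 < σ) :
    ∀ᵐ ω ∂prodMeasure, Tendsto (fun N : ℕ => partialS σ N ω) atTop (𝓝 (S σ ω)) := by
  have hs : Summable fun p : Nat.Primes => (3 * ((p : ℕ) : ℝ) ^ (-σ)) ^ 2 := by
    simp_rw [mul_pow]
    exact (summable_rpow_neg_sq hσ).mul_left _
  have hb := fun p : Nat.Primes => norm_logTerm_le (rpow_neg_pos σ p).le (rpow_neg_le hσ p)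
  have hint := fun p : Nat.Primes => integrable_logTerm (rpow_neg_pos σ p).le (rpow_neg_le hσ p)
  have h0 := fun p : Nat.Primes => integral_logTerm (rpow_neg_pos σ p).le
    ((rpow_neg_le hσ p).trans_lt (by norm_num))
  filter_upwards [
    ae_exists_tendsto_sum_primesLT
      (fun p : Nat.Primes => Complex.measurable_re.comp (measurable_logTerm (((p : ℕ) : ℝ) ^ (-σ))))
      (fun p z => (Complex.abs_re_le_norm _).trans (hb p z))
      (fun p => (integral_re (hint p)).trans (by rw [h0]; simp)) hs,
    ae_exists_tendsto_sum_primesLT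
      (fun p : Nat.Primes => Complex.measurable_im.comp (measurable_logTerm (((p : ℕ) : ℝ) ^ (-σ))))
      (fun p z => (Complex.abs_im_le_norm _).trans (hb p z))
      (fun p => (integral_im (hint p)).trans (by rw [h0]; simp)) hs] with ω ⟨x, hx⟩ ⟨y, hy⟩
  refine tendsto_nhds_limUnder ⟨x + y * Complex.I, ?_⟩
  have h := ((Complex.continuous_ofReal.tendsto _).comp hx).add
    (((Complex.continuous_ofReal.tendsto _).comp hy).mul_const Complex.I)
  refine h.congr fun N => ?_
  simp only [Function.comp_apply]
  rw [partialS_eq, ← Complex.re_sum, ← Complex.im_sum, Complex.re_add_im]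

theorem charFun_argLaw_rpow_neg (σ x : ℝ) (p : Nat.Primes) :
    charFun (argLaw (((p : ℕ) : ℝ) ^ (-σ))) x = I (((p : ℕ) : ℝ) ^ σ) x := by
  rw [Real.rpow_neg (Nat.cast_nonneg _), charFun_argLaw]

theorem integral_cexp_logTerm_im (a x : ℝ) :
    ∫ z, Complex.exp (Complex.I * x * (logTerm a z).im) ∂circleMeasure = charFun (argLaw a) x := by
  rw [charFun_apply_real, argLaw, integral_map (measurable_logTerm_im a).aemeasurable
    (Continuous.aestronglyMeasurable (by fun_prop))]
  refine integral_congr_ae (ae_of_all _ fun z => ?_)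
  simp only
  ring_nf

theorem integral_cexp_partialS_im (σ x : ℝ) (N : ℕ) :
    ∫ ω, Complex.exp (Complex.I * x * (partialS σ N ω).im) ∂prodMeasure =
      ∏ p ∈ primesLT N, I (((p : ℕ) : ℝ) ^ σ) x := by
  set f : Nat.Primes → Circle → ℂ := fun p z =>
    Complex.exp (Complex.I * x * (logTerm (((p : ℕ) : ℝ) ^ (-σ)) z).im)
  have hf : ∀ p, Measurable (f p) := fun p => by
    have := measurable_logTerm_im (((p : ℕ) : ℝ) ^ (-σ))
    exact Complex.measurable_exp.comp
      ((Complex.measurable_ofReal.comp this).const_mul _)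
  have hind : iIndepFun (fun (p : primesLT N) (ω : Omega) => ω p) prodMeasure :=
    (iIndepFun_infinitePi (X := fun _ => id) fun _ => measurable_id).precomp
      Subtype.val_injective
  have h := hind.integral_fun_prod_comp (f := fun p : primesLT N => f p)
    (fun p => (measurable_pi_apply _).aemeasurable) fun p => (hf p).aestronglyMeasurable
  have hprod : ∀ ω : Omega, Complex.exp (Complex.I * x * (partialS σ N ω).im) =
      ∏ p : primesLT N, f p (ω p) := fun ω => by
    rw [Finset.prod_coe_sort (primesLT N) fun p => f p (ω p), partialS_eq, Complex.im_sum,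
      ← Complex.exp_sum]
    push_cast
    rw [Finset.mul_sum]
  simp_rw [hprod]
  rw [h, ← Finset.prod_coe_sort (primesLT N)]
  refine Finset.prod_congr rfl fun p _ => ?_
  rw [← charFun_argLaw_rpow_neg, ← integral_cexp_logTerm_im]
  have he := Measure.infinitePi_map_eval (fun _ : Nat.Primes => circleMeasure) p
  conv_rhs => rw [← he]
  rw [integral_map (measurable_pi_apply _).aemeasurable (hf p).aestronglyMeasurable]
  rfl

theorem tendsto_prod_I {σ : ℝ} (hσ : 1 / 2 < σ) (x : ℝ) :
    Tendsto (fun N => ∏ p ∈ primesLT N, I (((p : ℕ) : ℝ) ^ σ) x) atTop (𝓝 (psi σ x)) := by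
  simp_rw [← integral_cexp_partialS_im]
  have hnorm : ∀ u : ℝ, ‖Complex.exp (Complex.I * x * u)‖ ≤ 1 := fun u => by
    rw [mul_assoc, mul_comm, ← Complex.ofReal_mul, Complex.norm_exp_ofReal_mul_I]
  have hcont : Continuous fun z : ℂ => Complex.exp (Complex.I * x * z.im) := by fun_prop
  refine tendsto_integral_of_dominated_convergence (fun _ => 1)
    (fun N => (hcont.measurable.comp (measurable_partialS σ N)).aestronglyMeasurable)
    (integrable_const _) (fun N => ae_of_all _ fun ω => hnorm _) ?_
  filter_upwards [ae_tendsto_partialS hσ] with ω hω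
  exact (hcont.tendsto _).comp hω

/-- The variable is centred, so the linear term of the exponential integrates to zero and the error
is quadratic in `a`. -/
theorem norm_charFun_argLaw_sub_one_le {a : ℝ} (h0 : 0 ≤ a) (ha : a ≤ 3 / 4) (x : ℝ) :
    ‖charFun (argLaw a) x - 1‖ ≤ (3 * |x|) ^ 2 * Real.exp (3 * |x|) * a ^ 2 := by
  have hlin : ∫ z, Complex.I * x * (logTerm a z).im ∂circleMeasure = 0 := by
    rw [integral_const_mul, integral_complex_ofReal]
    have : ∫ z, (logTerm a z).im ∂circleMeasure = 0 :=
      (integral_im (integrable_logTerm h0 ha)).trans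
        (by rw [integral_logTerm h0 (by linarith)]; simp)
    rw [this]
    simp
  have hu : ∀ z, ‖Complex.I * x * ((logTerm a z).im : ℂ)‖ ≤ 3 * |x| * a := fun z => by
    rw [norm_mul, norm_mul, Complex.norm_I, one_mul, Complex.norm_real, Complex.norm_real,
      Real.norm_eq_abs, Real.norm_eq_abs]
    have := (Complex.abs_im_le_norm _).trans (norm_logTerm_le h0 ha z)
    calc _ ≤ |x| * (3 * a) := by gcongr
      _ = _ := by ring
  have hmu : Measurable fun z => Complex.I * x * ((logTerm a z).im : ℂ) :=
    (Complex.measurable_ofReal.comp (measurable_logTerm_im a)).const_mul _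
  have hiu : Integrable (fun z => Complex.I * x * ((logTerm a z).im : ℂ)) circleMeasure :=
    Integrable.of_bound hmu.aestronglyMeasurable _ (ae_of_all _ hu)
  have hie : Integrable (fun z => Complex.exp (Complex.I * x * ((logTerm a z).im : ℂ)))
      circleMeasure := by
    refine Integrable.of_bound (Complex.measurable_exp.comp hmu).aestronglyMeasurable 1
      (ae_of_all _ fun z => ?_)
    rw [mul_assoc, mul_comm, ← Complex.ofReal_mul,
      Complex.norm_exp_ofReal_mul_I]
  have heq : charFun (argLaw a) x - 1 = ∫ z,
      (Complex.exp (Complex.I * x * ((logTerm a z).im : ℂ)) -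
        ∑ m ∈ Finset.range 2, (Complex.I * x * ((logTerm a z).im : ℂ)) ^ m / m.factorial)
        ∂circleMeasure := by
    simp only [Finset.sum_range_succ, Finset.range_zero, Finset.sum_empty, zero_add, pow_zero,
      pow_one, Nat.factorial, Nat.cast_one, div_one, mul_one]
    have hsum : Integrable (fun z => 1 + Complex.I * x * ((logTerm a z).im : ℂ)) circleMeasure :=
      (integrable_const _).add hiu
    rw [integral_sub hie hsum, integral_add (integrable_const _) hiu,
      hlin, integral_cexp_logTerm_im]
    simp
  rw [heq]
  refine (norm_integral_le_of_norm_le_const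
    (C := (3 * |x|) ^ 2 * Real.exp (3 * |x|) * a ^ 2) (ae_of_all _ fun z => ?_)).trans (by simp)
  refine (Complex.norm_exp_sub_sum_le_norm_mul_exp _ 2).trans ?_
  calc _ ≤ (3 * |x| * a) ^ 2 * Real.exp (3 * |x| * a) := by
        gcongr
        · exact hu z
        · exact hu z
    _ ≤ (3 * |x| * a) ^ 2 * Real.exp (3 * |x|) := by
        have : 3 * |x| * a ≤ 3 * |x| := mul_le_of_le_one_right (by positivity) (by linarith)
        exact mul_le_mul_of_nonneg_left (Real.exp_le_exp.2 this) (sq_nonneg _)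
    _ = _ := by ring

/-- Summability of `I - 1` makes the product unconditional; its value is then read off along the
primes in increasing order. -/
theorem hasProd_I {σ : ℝ} (hσ : 1 / 2 < σ) (x : ℝ) :
    HasProd (fun p : Nat.Primes => I (((p : ℕ) : ℝ) ^ σ) x) (psi σ x) := by
  have hs : Summable fun p : Nat.Primes => ‖I (((p : ℕ) : ℝ) ^ σ) x - 1‖ := by
    refine Summable.of_nonneg_of_le (fun _ => norm_nonneg _) (fun p => ?_)
      ((summable_rpow_neg_sq hσ).mul_left ((3 * |x|) ^ 2 * Real.exp (3 * |x|)))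
    rw [← charFun_argLaw_rpow_neg]
    exact norm_charFun_argLaw_sub_one_le (rpow_neg_pos σ p).le (rpow_neg_le hσ p) x
  have hmul := multipliable_one_add_of_summable hs
  simp only [add_sub_cancel] at hmul
  have h := hmul.hasProd
  rwa [tendsto_nhds_unique (h.comp tendsto_primesLT) (tendsto_prod_I hσ x)] at h

theorem infinite_zeros_I {σ : ℝ} (hσ : 1 / 2 < σ) (p : Nat.Primes) :
    {x : ℝ | I (((p : ℕ) : ℝ) ^ σ) x = 0}.Infinite := by
  simp_rw [← charFun_argLaw_rpow_neg]
  exact infinite_zeros_charFun_argLaw (rpow_neg_pos σ p)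
    ((rpow_neg_le hσ p).trans_lt (by norm_num))

end BohrJessen

theorem mainTheorem9 (σ : ℝ) (hσ : 1 / 2 < σ) :
    -- the random variable `S` is well defined
    (∀ᵐ ω ∂BohrJessen.prodMeasure,
      Tendsto (fun N : ℕ => BohrJessen.partialS σ N ω) atTop (𝓝 (BohrJessen.S σ ω))) ∧
    Measurable (BohrJessen.S σ) ∧
    -- the characteristic function is the product of the factors `I (p ^ σ, x)`
    (∀ x : ℝ, HasProd (fun p : Nat.Primes => BohrJessen.I (((p : ℕ) : ℝ) ^ σ) x)
      (BohrJessen.psi σ x)) ∧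
    -- each factor has infinitely many real zeros
    (∀ p : Nat.Primes, {x : ℝ | BohrJessen.I (((p : ℕ) : ℝ) ^ σ) x = 0}.Infinite) ∧
    -- the characteristic function has infinitely many real zeros
    {x : ℝ | BohrJessen.psi σ x = 0}.Infinite := by
  refine ⟨BohrJessen.ae_tendsto_partialS hσ, BohrJessen.measurable_S σ, BohrJessen.hasProd_I hσ,
    BohrJessen.infinite_zeros_I hσ, ?_⟩
  -- A product with one zero factor has value `0`, so the zeros of the factor at `2` already
  -- suffice.
  refine (BohrJessen.infinite_zeros_I hσ ⟨2, Nat.prime_two⟩).mono fun x hx => ?_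
  exact (BohrJessen.hasProd_I hσ x).unique (hasProd_zero_of_exists_eq_zero ⟨_, hx⟩)
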